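/- A closure space is a pair $(A,\mathcal{C}_A)$, where $A$ is a set and $\mathcal{C}_A$ is a set of subsets of $A$ closed under arbitrary intersections (in particular $A\in\mathcal{C}_A$). A morphism $\alpha:A\to B$ of closure spaces is a map with $\alpha^{-1}(B')\in\mathcal{C}_A$ for all $B'\in\mathcal{C}_B$. Let $\mathbf{FCLS}$ be the category of closure spaces with finite underlying set; it has pullbacks. Let $p:E\to B$ be a morphism in a category $\mathbf{C}$ with pullbacks. A descent datum for $p$ is a triple $(C,\gamma,\xi)$ with $\gamma:C\to E$ and $\xi:E\times_BC\to C$ (where $C$ lies over $B$ via $p\gamma$) such that $\gamma\xi=\pi_1$, $\xi\langle\gamma,1_C\rangle=1_C$ and $\xi(E\times_B\xi)=\xi(E\times_B\pi_2)$. A morphism $(C,\gamma,\xi)\to(C',\gamma',\xi')$ is a morphism $f:C\to C'$ with $\gamma'f=\gamma$ and $f\xi=\xi'(E\times_Bf)$; this gives a category $\mathrm{Des}(p)$. The comparison functor $K^p:(\mathbf{C}\downarrow B)\to\mathrm{Des}(p)$ sends $(A,\alpha)$ to $(E\times_BA,\pi_1,E\times_B\pi_2)$ and $f$ to $E\times_Bf$.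 The morphism $p$ is a descent morphism if $K^p$ is fully faithful, and an effective descent morphism if $K^p$ is an equivalence of categories. **Theorem 4.3.** A morphism in $\mathbf{FCLS}$ is a descent morphism if and only if it is a pullback-stable regular epimorphism (that is, each of its pullbacks in $\mathbf{FCLS}$ is a regular epimorphism), and every descent morphism in $\mathbf{FCLS}$ is an effective descent morphism. -/

import Mathlib

open CategoryTheory CategoryTheory.Limits

universe v u

/-! ### Descent data and descent morphisms in a category with pullbacks -/

namespace Descent

section

variable {𝒞 : Type u} [Category.{v} 𝒞] [HasPullbacks 𝒞]

/-- The morphism `E ×_B f : E ×_B X ⟶ E ×_B Y` induced by a morphism `f : X ⟶ Y` over `B`. -/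
noncomputable def baseMap {E B X Y : 𝒞} (p : E ⟶ B) {x : X ⟶ B} {y : Y ⟶ B} (f : X ⟶ Y)
    (w : f ≫ y = x) : pullback p x ⟶ pullback p y :=
  pullback.lift (pullback.fst p x) (pullback.snd p x ≫ f)
    (by rw [Category.assoc, w, pullback.condition])

@[simp]
theorem baseMap_fst {E B X Y : 𝒞} (p : E ⟶ B) {x : X ⟶ B} {y : Y ⟶ B} (f : X ⟶ Y)
    (w : f ≫ y = x) : baseMap p f w ≫ pullback.fst p y = pullback.fst p x :=
  pullback.lift_fst _ _ _

@[simp]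
theorem baseMap_snd {E B X Y : 𝒞} (p : E ⟶ B) {x : X ⟶ B} {y : Y ⟶ B} (f : X ⟶ Y)
    (w : f ≫ y = x) : baseMap p f w ≫ pullback.snd p y = pullback.snd p x ≫ f :=
  pullback.lift_snd _ _ _

@[simp]
theorem baseMap_fst_assoc {E B X Y Z : 𝒞} (p : E ⟶ B) {x : X ⟶ B} {y : Y ⟶ B} (f : X ⟶ Y)
    (w : f ≫ y = x) (h : E ⟶ Z) :
    baseMap p f w ≫ pullback.fst p y ≫ h = pullback.fst p x ≫ h := by
  rw [← Category.assoc, baseMap_fst]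

@[simp]
theorem baseMap_snd_assoc {E B X Y Z : 𝒞} (p : E ⟶ B) {x : X ⟶ B} {y : Y ⟶ B} (f : X ⟶ Y)
    (w : f ≫ y = x) (h : Y ⟶ Z) :
    baseMap p f w ≫ pullback.snd p y ≫ h = pullback.snd p x ≫ f ≫ h := by
  rw [← Category.assoc, baseMap_snd, Category.assoc]

/-- Descent data for `p : E ⟶ B`: a triple `(C, γ, ξ)` with `γ : C ⟶ E` and
`ξ : E ×_B C ⟶ C`, where `C` lies over `B` by `p γ`, such that
`γ ξ = π₁`, `ξ ⟨γ, 1_C⟩ = 1_C` and `ξ (E ×_B ξ) = ξ (E ×_B π₂)` on `E ×_B (E ×_B C)`,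
where `E ×_B C` lies over `B` by `p π₁ = p γ π₂`. -/
structure DescentData {E B : 𝒞} (p : E ⟶ B) where
  /-- the object `C` -/
  obj : 𝒞
  /-- the structure morphism `γ : C ⟶ E` -/
  γ : obj ⟶ E
  /-- the action `ξ : E ×_B C ⟶ C` -/
  ξ : pullback p (γ ≫ p) ⟶ obj
  ξ_γ : ξ ≫ γ = pullback.fst p (γ ≫ p)
  unit : pullback.lift γ (𝟙 obj) (by simp) ≫ ξ = 𝟙 obj
  assoc :
    baseMap p (x := pullback.fst p (γ ≫ p) ≫ p) (y := γ ≫ p) ξ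
        (by rw [← Category.assoc, ξ_γ]) ≫ ξ =
      baseMap p (x := pullback.fst p (γ ≫ p) ≫ p) (y := γ ≫ p) (pullback.snd p (γ ≫ p))
        pullback.condition.symm ≫ ξ

namespace DescentData

/-- A morphism `(C, γ, ξ) ⟶ (C', γ', ξ')` of descent data: a morphism `f : C ⟶ C'` over `E`
with `f ξ = ξ' (E ×_B f)`. -/
@[ext]
structure Hom {E B : 𝒞} {p : E ⟶ B} (D D' : DescentData p) where
  /-- the underlying morphism -/
  hom : D.obj ⟶ D'.obj
  w : hom ≫ D'.γ = D.γ
  comm : D.ξ ≫ hom = baseMap p hom (by rw [← Category.assoc, w]) ≫ D'.ξ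

/-- The category `Des(p)` of descent data for `p`. -/
instance {E B : 𝒞} (p : E ⟶ B) : Category (DescentData p) where
  Hom D D' := Hom D D'
  id D :=
    { hom := 𝟙 D.obj
      w := Category.id_comp _
      comm := by
        have h : baseMap p (x := D.γ ≫ p) (y := D.γ ≫ p) (𝟙 D.obj) (Category.id_comp _) =
            𝟙 _ := by
          apply pullback.hom_ext <;> simp
        rw [h, Category.id_comp, Category.comp_id] }
  comp {D D' D''} f g :=
    { hom := f.hom ≫ g.hom
      w := by rw [Category.assoc, g.w, f.w]
      comm := by
        rw [← Category.assoc, f.comm, Category.assoc, g.comm, ← Category.assoc]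
        congr 1
        apply pullback.hom_ext <;> simp }
  id_comp f := by ext; exact Category.id_comp _
  comp_id f := by ext; exact Category.comp_id _
  assoc f g h := by ext; exact Category.assoc _ _ _

@[simp]
theorem id_hom {E B : 𝒞} {p : E ⟶ B} (D : DescentData p) : Hom.hom (𝟙 D) = 𝟙 D.obj := rfl

@[simp]
theorem comp_hom {E B : 𝒞} {p : E ⟶ B} {D D' D'' : DescentData p} (f : D ⟶ D')
    (g : D' ⟶ D'') : Hom.hom (f ≫ g) = f.hom ≫ g.hom := rfl

end DescentData

/-- The comparison functor `K^p : (𝒞 ↓ B) ⥤ Des(p)`, which sends `(A, α)` to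
`(E ×_B A, π₁, E ×_B π₂)` and `f` to `E ×_B f`. -/
noncomputable def comparison {E B : 𝒞} (p : E ⟶ B) : Over B ⥤ DescentData p where
  obj A :=
    { obj := pullback p A.hom
      γ := pullback.fst p A.hom
      ξ := baseMap p (pullback.snd p A.hom) pullback.condition.symm
      ξ_γ := baseMap_fst _ _ _
      unit := by
        apply pullback.hom_ext
        · rw [Category.assoc, baseMap_fst, pullback.lift_fst, Category.id_comp]
        · rw [Category.assoc, baseMap_snd, pullback.lift_snd_assoc]
      assoc := by
        apply pullback.hom_ext
        · simp
        · simp only [Category.assoc, baseMap_snd, baseMap_snd_assoc] }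
  map {A A'} f :=
    { hom := baseMap p f.left (Over.w f)
      w := baseMap_fst _ _ _
      comm := by
        apply pullback.hom_ext
        · simp
        · simp only [Category.assoc, baseMap_snd, baseMap_snd_assoc] }
  map_id A := by
    apply DescentData.Hom.ext
    apply pullback.hom_ext <;> simp
  map_comp f g := by
    apply DescentData.Hom.ext
    apply pullback.hom_ext
    · simp
    · simp only [DescentData.comp_hom, Category.assoc, baseMap_snd, baseMap_snd_assoc,
        Over.comp_left]

/-- `p` is a descent morphism if the comparison functor `K^p` is fully faithful. -/
def IsDescentMorphism {E B : 𝒞} (p : E ⟶ B) : Prop :=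
  (comparison p).Full ∧ (comparison p).Faithful

/-- `p` is an effective descent morphism if the comparison functor `K^p` is an equivalence of
categories. -/
def IsEffectiveDescentMorphism {E B : 𝒞} (p : E ⟶ B) : Prop :=
  (comparison p).IsEquivalence

/-- `p` is a pullback stable regular epimorphism if every pullback of `p` (along any morphism
with codomain `B`) is a regular epimorphism. -/
def IsPullbackStableRegularEpi {E B : 𝒞} (p : E ⟶ B) : Prop :=
  (MorphismProperty.regularEpi 𝒞).universally p

end

end Descent

/-! ### Closure spaces -/

/-- A closure space structure on `A`: a set of subsets of `A` (the closed subsets) that is closed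
under arbitrary intersections; the intersection of the empty family is `A` itself. -/
class ClosureSpace (A : Type u) where
  /-- the closed subsets -/
  closedSets : Set (Set A)
  sInter_mem : ∀ S : Set (Set A), S ⊆ closedSets → ⋂₀ S ∈ closedSets

/-- The objects of the category of closure spaces. -/
structure CLS : Type (u + 1) where
  /-- the underlying set -/
  carrier : Type u
  [str : ClosureSpace carrier]

namespace CLS

attribute [instance] CLS.str

/-- The closed subsets of a closure space. -/
def closedSets (A : CLS.{u}) : Set (Set A.carrier) := ClosureSpace.closedSets

/-- A morphism of closure spaces: a map for which inverse images of closed sets are closed. -/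
@[ext]
structure Hom (A B : CLS.{u}) where
  /-- the underlying map -/
  toFun : A.carrier → B.carrier
  preimage_mem : ∀ T ∈ B.closedSets, toFun ⁻¹' T ∈ A.closedSets

instance : Category CLS.{u} where
  Hom A B := Hom A B
  id A := { toFun := id, preimage_mem := fun _ h => h }
  comp f g :=
    { toFun := g.toFun ∘ f.toFun
      preimage_mem := fun T h => f.preimage_mem _ (g.preimage_mem T h) }

@[ext]
theorem hom_ext {A B : CLS.{u}} {f g : A ⟶ B} (h : ∀ x, Hom.toFun f x = Hom.toFun g x) :
    f = g :=
  Hom.ext (funext h)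

@[simp]
theorem id_toFun (A : CLS.{u}) : Hom.toFun (𝟙 A) = id := rfl

@[simp]
theorem comp_toFun {A B C : CLS.{u}} (f : A ⟶ B) (g : B ⟶ C) :
    Hom.toFun (f ≫ g) = g.toFun ∘ f.toFun := rfl

end CLS

/-- The category of finite closure spaces: the full subcategory of the category of closure spaces
on those whose underlying set is finite. -/
abbrev FCLS : Type (u + 1) :=
  ObjectProperty.FullSubcategory (fun A : CLS.{u} => Finite A.carrier)

namespace FCLS

variable {E A B : FCLS.{u}} (p : E ⟶ B) (α : A ⟶ B)

/-- The pullback `E ×_B A = {(e, a) | p e = α a}`, whose closed sets are the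
`π₁⁻¹(E') ∩ π₂⁻¹(A')` with `E'` and `A'` closed. -/
def pullbackObj : FCLS.{u} where
  obj :=
    { carrier := {x : E.obj.carrier × A.obj.carrier // p.hom.toFun x.1 = α.hom.toFun x.2}
      str :=
        { closedSets := {Z | ∃ E' ∈ E.obj.closedSets, ∃ A' ∈ A.obj.closedSets,
            Z = {x | x.1.1 ∈ E' ∧ x.1.2 ∈ A'}}
          sInter_mem := by
            intro S hS
            refine ⟨⋂₀ {E' | E' ∈ E.obj.closedSets ∧ ∃ A' ∈ A.obj.closedSets,
                {x | x.1.1 ∈ E' ∧ x.1.2 ∈ A'} ∈ S},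
              ClosureSpace.sInter_mem _ fun _ h => h.1,
              ⋂₀ {A' | A' ∈ A.obj.closedSets ∧ ∃ E' ∈ E.obj.closedSets,
                {x | x.1.1 ∈ E' ∧ x.1.2 ∈ A'} ∈ S},
              ClosureSpace.sInter_mem _ fun _ h => h.1, ?_⟩
            ext x
            constructor
            · intro h
              exact ⟨fun E' ⟨_, A', _, hS'⟩ => (h _ hS').1, fun A' ⟨_, E', _, hS'⟩ => (h _ hS').2⟩
            · rintro ⟨h₁, h₂⟩ Z hZ
              obtain ⟨E', hE, A', hA, rfl⟩ := hS hZ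
              exact ⟨h₁ E' ⟨hE, A', hA, hZ⟩, h₂ A' ⟨hA, E', hE, hZ⟩⟩ } }
  property := by
    have := E.property
    have := A.property
    exact Subtype.finite

theorem univ_mem (X : CLS.{u}) : Set.univ ∈ X.closedSets := by
  have h := ClosureSpace.sInter_mem (A := X.carrier) ∅ (Set.empty_subset _)
  rwa [Set.sInter_empty] at h

theorem inter_mem (X : CLS.{u}) {S T : Set X.carrier} (hS : S ∈ X.closedSets)
    (hT : T ∈ X.closedSets) : S ∩ T ∈ X.closedSets := by
  have h := ClosureSpace.sInter_mem (A := X.carrier) {S, T} (by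
    rintro U (rfl | rfl)
    exacts [hS, hT])
  rwa [Set.sInter_pair] at h

/-- The first projection. -/
def pullbackFst : pullbackObj p α ⟶ E :=
  ObjectProperty.homMk
    { toFun := fun x => x.1.1
      preimage_mem := fun T hT => ⟨T, hT, Set.univ, univ_mem _, by
        ext x
        exact (and_iff_left trivial).symm⟩ }

/-- The second projection. -/
def pullbackSnd : pullbackObj p α ⟶ A :=
  ObjectProperty.homMk
    { toFun := fun x => x.1.2
      preimage_mem := fun T hT => ⟨Set.univ, univ_mem _, T, hT, by
        ext x
        exact (and_iff_right trivial).symm⟩ }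

theorem isPullback : IsPullback (pullbackFst p α) (pullbackSnd p α) p α := by
  have w : pullbackFst p α ≫ p = pullbackSnd p α ≫ α := by
    ext x
    exact x.2
  refine ⟨⟨w⟩, ⟨PullbackCone.IsLimit.mk w (fun s => ObjectProperty.homMk
      { toFun := fun x => ⟨(s.fst.hom.toFun x, s.snd.hom.toFun x),
          congrArg (fun f => f.hom.toFun x) s.condition⟩
        preimage_mem := ?_ }) ?_ ?_ ?_⟩⟩
  · rintro T ⟨E', hE, A', hA, rfl⟩
    exact inter_mem _ (s.fst.hom.preimage_mem _ hE) (s.snd.hom.preimage_mem _ hA)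
  · intro s
    rfl
  · intro s
    rfl
  · intro s m h₁ h₂
    ext x
    apply Subtype.ext
    apply Prod.ext
    · exact congrArg (fun f => f.hom.toFun x) h₁
    · exact congrArg (fun f => f.hom.toFun x) h₂

instance : HasPullbacks FCLS.{u} :=
  @hasPullbacks_of_hasLimit_cospan _ _ fun {_ _ _} {f} {g} => (isPullback f g).hasPullback

end FCLS

/-! Both conditions on `p` are equivalent to a lifting property, `LiftsClosure`: each point of the
closure of `T` is the image of a point of the closure of `p⁻¹ T`. Since the closed sets of a
pullback are boxes, this property makes every pullback of `p` a quotient map.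

Conversely, suppose `b` lies in the closure of `T`, but no point of the closure of `p⁻¹ T` lies over
`b`. Refine `B` so that the only closure condition left is that `b` belongs to every closed set
containing `T`. Then `T` is not closed in the refinement, but its inverse image in the pullback is
the closed box on `cl (p⁻¹ T)` and `insert b T`. So this pullback is not a quotient map. Declaring
`T` closed as well does not change the pullback, so `K^p` inverts a noninvertible morphism and `p`
is not a descent morphism.

For effectiveness, `K^p` is essentially surjective for every `p`. Divide a descent datum `C` by its
action; the map from `C` to the pullback of the quotient is bijective, and each closed `S` in `C`
must be shown to be a box. By finiteness there is a maximal closed `T` containing `S` that meets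
`γ⁻¹ (cl (γ S))` only in `S`; continuity of the action and maximality make `T` saturated
(`exists_saturated_closed`). -/

namespace FCLS

/-! ### Closures and basic finite closure spaces -/

/-- The closure of a subset: the intersection of the closed subsets that contain it. -/
def cl (X : FCLS.{u}) (S : Set X.obj.carrier) : Set X.obj.carrier :=
  ⋂₀ {T | T ∈ X.obj.closedSets ∧ S ⊆ T}

section Closure

variable {X Y : FCLS.{u}} {S T : Set X.obj.carrier}

theorem cl_mem (S : Set X.obj.carrier) : X.cl S ∈ X.obj.closedSets :=
  ClosureSpace.sInter_mem _ fun _ h => h.1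

theorem subset_cl (S : Set X.obj.carrier) : S ⊆ X.cl S :=
  Set.subset_sInter fun _ h => h.2

theorem cl_subset (hT : T ∈ X.obj.closedSets) (h : S ⊆ T) : X.cl S ⊆ T :=
  Set.sInter_subset_of_mem ⟨hT, h⟩

theorem cl_mono (h : S ⊆ T) : X.cl S ⊆ X.cl T :=
  cl_subset (cl_mem T) (h.trans (subset_cl T))

theorem mem_closedSets_of_cl_subset (h : X.cl S ⊆ S) : S ∈ X.obj.closedSets := by
  have := cl_mem S
  rwa [h.antisymm (subset_cl S)] at this

theorem map_mem_cl (f : X ⟶ Y) {T : Set Y.obj.carrier} {x : X.obj.carrier}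
    (hx : x ∈ X.cl S) (h : ∀ s ∈ S, f.hom.toFun s ∈ T) : f.hom.toFun x ∈ Y.cl T :=
  cl_subset (f.hom.preimage_mem _ (cl_mem T)) (fun s hs => subset_cl T (h s hs)) hx

end Closure

theorem toFun_congr {X Y : FCLS.{u}} {f g : X ⟶ Y} (h : f = g) (x : X.obj.carrier) :
    f.hom.toFun x = g.hom.toFun x :=
  congrArg (fun f => f.hom.toFun x) h

theorem hom_ext {X Y : FCLS.{u}} {f g : X ⟶ Y} (h : ∀ x, f.hom.toFun x = g.hom.toFun x) :
    f = g :=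
  ObjectProperty.hom_ext _ (CLS.hom_ext h)

/-- The finite closure space with a given set of closed subsets. -/
def of (X : Type u) [Finite X] (𝒯 : Set (Set X))
    (h : ∀ S : Set (Set X), S ⊆ 𝒯 → ⋂₀ S ∈ 𝒯) : FCLS.{u} where
  obj := { carrier := X, str := ⟨𝒯, h⟩ }
  property := ‹Finite X›

/-- The discrete closure space, in which all subsets are closed. -/
abbrev discrete (X : Type u) [Finite X] : FCLS.{u} :=
  of X Set.univ fun _ _ => trivial

/-- A map out of a discrete closure space, as a morphism. -/
def discreteHom {X : Type u} [Finite X] {Y : FCLS.{u}} (f : X → Y.obj.carrier) :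
    discrete X ⟶ Y :=
  ObjectProperty.homMk { toFun := f, preimage_mem := fun _ _ => trivial }

/-- The indiscrete closure space, in which only the whole space is closed. -/
abbrev indiscrete (X : Type u) [Finite X] : FCLS.{u} :=
  of X {Set.univ} fun _ hS => Set.sInter_eq_univ.2 fun _ hs => hS hs

/-- A map into an indiscrete closure space, as a morphism. -/
def indiscreteHom {X : FCLS.{u}} {Y : Type u} [Finite Y] (f : X.obj.carrier → Y) :
    X ⟶ indiscrete Y :=
  ObjectProperty.homMk
    { toFun := f
      preimage_mem := by
        rintro T (rfl : T = Set.univ)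
        exact univ_mem _ }

theorem isIso_of_bijective {X Y : FCLS.{u}} (f : X ⟶ Y) (hf : Function.Bijective f.hom.toFun)
    (h : ∀ Z ∈ X.obj.closedSets, ∃ W ∈ Y.obj.closedSets, Z = f.hom.toFun ⁻¹' W) : IsIso f := by
  obtain ⟨g, hg₁, hg₂⟩ := Function.bijective_iff_has_inverse.1 hf
  refine ⟨ObjectProperty.homMk { toFun := g, preimage_mem := fun Z hZ => ?_ },
    hom_ext hg₁, hom_ext hg₂⟩
  obtain ⟨W, hW, rfl⟩ := h Z hZ
  rwa [← Set.preimage_comp, hg₂.comp_eq_id, Set.preimage_id]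

/-! ### Points and closed sets of a pullback -/

section Pullback

variable {P E A B : FCLS.{u}} {f : P ⟶ E} {g : P ⟶ A} {p : E ⟶ B} {α : A ⟶ B}

theorem exists_of_isPullback (h : IsPullback f g p α) {e : E.obj.carrier} {a : A.obj.carrier}
    (w : p.hom.toFun e = α.hom.toFun a) : ∃ z, f.hom.toFun z = e ∧ g.hom.toFun z = a := by
  let j := h.lift (pullbackFst p α) (pullbackSnd p α) (isPullback p α).w
  exact ⟨j.hom.toFun ⟨(e, a), w⟩, toFun_congr (h.lift_fst _ _ (isPullback p α).w) _,
    toFun_congr (h.lift_snd _ _ (isPullback p α).w) _⟩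

/-- Points are the morphisms from the discrete one-point space. -/
theorem ext_of_isPullback (h : IsPullback f g p α) {z z' : P.obj.carrier}
    (h₁ : f.hom.toFun z = f.hom.toFun z') (h₂ : g.hom.toFun z = g.hom.toFun z') : z = z' := by
  have : discreteHom (X := PUnit.{u + 1}) (fun _ => z) = discreteHom (fun _ => z') :=
    h.hom_ext (hom_ext fun _ => h₁) (hom_ext fun _ => h₂)
  exact toFun_congr this PUnit.unit

theorem mem_closedSets_iff_of_isPullback (h : IsPullback f g p α) {Z : Set P.obj.carrier} :
    Z ∈ P.obj.closedSets ↔ ∃ E' ∈ E.obj.closedSets, ∃ A' ∈ A.obj.closedSets,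
      Z = {z | f.hom.toFun z ∈ E' ∧ g.hom.toFun z ∈ A'} := by
  constructor
  · intro hZ
    let i := (isPullback p α).lift f g h.w
    let j := h.lift (pullbackFst p α) (pullbackSnd p α) (isPullback p α).w
    have hij : i ≫ j = 𝟙 P := by
      apply h.hom_ext
      · rw [Category.assoc, h.lift_fst, (isPullback p α).lift_fst, Category.id_comp]
      · rw [Category.assoc, h.lift_snd, (isPullback p α).lift_snd, Category.id_comp]
    obtain ⟨E', hE, A', hA, hj⟩ := j.hom.preimage_mem Z hZ
    refine ⟨E', hE, A', hA, ?_⟩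
    ext z
    have hz : j.hom.toFun (i.hom.toFun z) = z := toFun_congr hij z
    have h₁ : (i.hom.toFun z).1.1 = f.hom.toFun z :=
      toFun_congr ((isPullback p α).lift_fst f g h.w) z
    have h₂ : (i.hom.toFun z).1.2 = g.hom.toFun z :=
      toFun_congr ((isPullback p α).lift_snd f g h.w) z
    have : i.hom.toFun z ∈ j.hom.toFun ⁻¹' Z ↔ _ := Set.ext_iff.1 hj (i.hom.toFun z)
    rw [Set.mem_preimage, hz] at this
    rw [this]
    change _ ∧ _ ↔ _ ∧ _
    rw [h₁, h₂]
  · rintro ⟨E', hE, A', hA, rfl⟩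
    exact inter_mem _ (f.hom.preimage_mem _ hE) (g.hom.preimage_mem _ hA)

end Pullback

/-! ### Regular epimorphisms as quotient maps -/

section RegularEpi

variable {X Y : FCLS.{u}} (q : X ⟶ Y)

theorem surjective_of_epi [Epi q] : Function.Surjective q.hom.toFun := by
  classical
  intro y
  by_contra hy
  have h : (indiscreteHom fun z => ULift.up (decide (z = y)) : Y ⟶ indiscrete (ULift.{u} Bool)) =
      indiscreteHom fun _ => ULift.up false := by
    rw [← cancel_epi q]
    refine hom_ext fun x => congrArg ULift.up (decide_eq_false fun h => hy ⟨x, h⟩)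
  have := congrArg ULift.down (toFun_congr h y)
  change decide (y = y) = false at this
  simp at this

/-- A regular epimorphism is a quotient map. -/
theorem mem_closedSets_of_isRegularEpi [IsRegularEpi q] {T : Set Y.obj.carrier}
    (hT : q.hom.toFun ⁻¹' T ∈ X.obj.closedSets) : T ∈ Y.obj.closedSets := by
  have hq : Function.Surjective q.hom.toFun :=
    have := (IsRegularEpi.getStruct q).epi
    surjective_of_epi q
  have := Y.property
  -- With the quotient structure on the points of `Y`, the map `q` coequalizes its pair, so it
  -- factors through `q`; the factorization is the identity map, and its continuity is the claim.
  let Q : FCLS.{u} := of Y.obj.carrier {T | q.hom.toFun ⁻¹' T ∈ X.obj.closedSets} (by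
    intro S hS
    change q.hom.toFun ⁻¹' ⋂₀ S ∈ X.obj.closedSets
    rw [Set.preimage_sInter, ← Set.sInter_image]
    refine ClosureSpace.sInter_mem _ ?_
    rintro _ ⟨U, hU, rfl⟩
    exact hS hU)
  let k : X ⟶ Q := ObjectProperty.homMk
    { toFun := q.hom.toFun, preimage_mem := fun _ h => h }
  have hk : IsRegularEpi.left q ≫ k = IsRegularEpi.right q ≫ k :=
    hom_ext fun x => toFun_congr (IsRegularEpi.w q) x
  have hm : (IsRegularEpi.desc q k hk).hom.toFun = id := by
    funext y
    obtain ⟨x, rfl⟩ := hq y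
    exact toFun_congr (IsRegularEpi.fac q k hk) x
  have := (IsRegularEpi.desc q k hk).hom.preimage_mem T hT
  rwa [hm] at this

theorem isRegularEpi_of_surjective (hq : Function.Surjective q.hom.toFun)
    (h : ∀ T, q.hom.toFun ⁻¹' T ∈ X.obj.closedSets → T ∈ Y.obj.closedSets) : IsRegularEpi q := by
  have : Epi q := ⟨fun f g hfg => hom_ext fun y => by
    obtain ⟨x, rfl⟩ := hq y
    exact toFun_congr hfg x⟩
  refine IsRegularEpi.of_epi_of_exists fun Z k hk => ?_
  obtain ⟨s, hs⟩ := hq.hasRightInverse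
  have hks (x : X.obj.carrier) : k.hom.toFun (s (q.hom.toFun x)) = k.hom.toFun x := by
    obtain ⟨z, h₁, h₂⟩ := exists_of_isPullback (IsPullback.of_hasPullback q q)
      (hs (q.hom.toFun x))
    rw [← h₁, ← h₂]
    exact toFun_congr hk z
  refine ⟨ObjectProperty.homMk { toFun := k.hom.toFun ∘ s, preimage_mem := fun T hT => h _ ?_ },
    hom_ext hks⟩
  have : (q.hom.toFun ⁻¹' (k.hom.toFun ∘ s ⁻¹' T)) = k.hom.toFun ⁻¹' T := by
    ext x
    change k.hom.toFun (s (q.hom.toFun x)) ∈ T ↔ k.hom.toFun x ∈ T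
    rw [hks]
  rw [this]
  exact k.hom.preimage_mem T hT

end RegularEpi

/-! ### Lifting of closures and pullback stability -/

/-- Every closure in the codomain is the image of the closure of the inverse image. -/
def LiftsClosure {E B : FCLS.{u}} (p : E ⟶ B) : Prop :=
  ∀ (T : Set B.obj.carrier), ∀ b ∈ B.cl T, ∃ e ∈ E.cl (p.hom.toFun ⁻¹' T), p.hom.toFun e = b

theorem LiftsClosure.surjective {E B : FCLS.{u}} {p : E ⟶ B} (hp : LiftsClosure p) :
    Function.Surjective p.hom.toFun := by
  intro b
  obtain ⟨e, -, he⟩ := hp {b} b (subset_cl _ rfl)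
  exact ⟨e, he⟩

/-- Maps that lift closures are stable under pullback, and they are quotient maps. -/
theorem LiftsClosure.isPullbackStableRegularEpi {E B : FCLS.{u}} {p : E ⟶ B}
    (hp : LiftsClosure p) : Descent.IsPullbackStableRegularEpi p := by
  intro P A f α g h
  have h := h.flip
  refine isRegularEpi_of_surjective g (fun a => ?_) fun T hT => ?_
  · obtain ⟨e, he⟩ := hp.surjective (α.hom.toFun a)
    obtain ⟨z, -, hz⟩ := exists_of_isPullback h he
    exact ⟨z, hz⟩
  · obtain ⟨E', hE, A', hA, hZ⟩ := (mem_closedSets_iff_of_isPullback h).1 hT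
    refine mem_closedSets_of_cl_subset fun a ha => ?_
    have hmem (z : P.obj.carrier) : g.hom.toFun z ∈ T ↔ f.hom.toFun z ∈ E' ∧ g.hom.toFun z ∈ A' :=
      Set.ext_iff.1 hZ z
    -- The point `(e, a)` lies in the box `g⁻¹ T`: `E'` contains every point over `α T`, and `A'`
    -- contains `T` by surjectivity.
    obtain ⟨e, he, hea⟩ := hp (α.hom.toFun '' T) (α.hom.toFun a)
      (map_mem_cl α ha fun s hs => ⟨s, hs, rfl⟩)
    obtain ⟨z, rfl, rfl⟩ := exists_of_isPullback h hea
    refine (hmem z).2 ⟨cl_subset hE ?_ he, cl_subset hA ?_ ha⟩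
    · rintro e' ⟨t, ht, hte⟩
      obtain ⟨z', rfl, rfl⟩ := exists_of_isPullback h hte.symm
      exact ((hmem z').1 ht).1
    · intro t ht
      obtain ⟨e', he'⟩ := hp.surjective (α.hom.toFun t)
      obtain ⟨z', rfl, rfl⟩ := exists_of_isPullback h he'
      exact ((hmem z').1 ht).2

/-! ### Refinements of the base that detect a failure to lift closures -/

section Refinement

variable (B : FCLS.{u}) (T : Set B.obj.carrier) (b : B.obj.carrier)

/-- The finest closure structure on the underlying set of `B` such that `b` lies in the closure
of `T`. -/
def specialize : FCLS.{u} :=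
  have := B.property
  of B.obj.carrier {S | T ⊆ S → b ∈ S} fun _ hS hT _ hU =>
    hS hU (hT.trans (Set.sInter_subset_of_mem hU))

/-- The closure structure on the underlying set of `B` such that `b` lies in the closure of every
proper superset of `T`, and `T` is closed. -/
def specializeOff : FCLS.{u} :=
  have := B.property
  of B.obj.carrier {S | T ⊆ S → b ∈ S ∨ S = T} (by
    intro 𝒮 h𝒮 hT
    by_cases h : T ∈ 𝒮
    · exact .inr ((Set.sInter_subset_of_mem h).antisymm hT)
    · refine .inl fun U hU => ?_
      obtain hb | rfl := h𝒮 hU (hT.trans (Set.sInter_subset_of_mem hU))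
      exacts [hb, (h hU).elim])

/-- The identity map from the second refinement to the first. -/
def specializeOffHom : specializeOff B T b ⟶ specialize B T b :=
  ObjectProperty.homMk { toFun := id, preimage_mem := fun _ hS hT => .inl (hS hT) }

variable {B T b}

/-- The identity map from the first refinement to `B`. -/
def specializeHom (h : b ∈ B.cl T) : specialize B T b ⟶ B :=
  ObjectProperty.homMk { toFun := id, preimage_mem := fun _ hS hT => cl_subset hS hT h }

theorem notMem_closedSets_specialize (h : b ∉ T) :
    (T : Set (specialize B T b).obj.carrier) ∉ (specialize B T b).obj.closedSets :=
  fun hT => h (hT subset_rfl)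

/-- If no point over `b` lies in the closure of `p⁻¹ T`, then the inverse image of `T` in the
pullback is closed. -/
theorem preimage_mem_closedSets {E P : FCLS.{u}} {p : E ⟶ B} (h : b ∈ B.cl T)
    {f : P ⟶ E} {g : P ⟶ specialize B T b} (hP : IsPullback f g p (specializeHom h))
    (hb : ∀ e ∈ E.cl (p.hom.toFun ⁻¹' T), p.hom.toFun e ≠ b) :
    g.hom.toFun ⁻¹' T ∈ P.obj.closedSets := by
  have hg (z : P.obj.carrier) : p.hom.toFun (f.hom.toFun z) = g.hom.toFun z := toFun_congr hP.w z
  refine (mem_closedSets_iff_of_isPullback hP).2 ⟨_, cl_mem (p.hom.toFun ⁻¹' T), insert b T,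
    fun _ => Set.mem_insert _ _, ?_⟩
  ext z
  change g.hom.toFun z ∈ T ↔ f.hom.toFun z ∈ _ ∧ (g.hom.toFun z = b ∨ g.hom.toFun z ∈ T)
  rw [← hg]
  constructor
  · exact fun hz => ⟨subset_cl _ hz, .inr hz⟩
  · rintro ⟨h₁, h₂ | h₂⟩
    exacts [(hb _ h₁ h₂).elim, h₂]

end Refinement

theorem notMem_of_surjective {E B : FCLS.{u}} {p : E ⟶ B} (hp : Function.Surjective p.hom.toFun)
    {T : Set B.obj.carrier} {b : B.obj.carrier}
    (hb : ∀ e ∈ E.cl (p.hom.toFun ⁻¹' T), p.hom.toFun e ≠ b) : b ∉ T := by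
  intro hT
  obtain ⟨e, rfl⟩ := hp b
  exact hb e (subset_cl _ hT) rfl

theorem liftsClosure_of_isPullbackStableRegularEpi {E B : FCLS.{u}} {p : E ⟶ B}
    (hp : Descent.IsPullbackStableRegularEpi p) : LiftsClosure p := by
  have hsurj : Function.Surjective p.hom.toFun := by
    have : IsRegularEpi p := MorphismProperty.universally_le _ _ hp
    have := (IsRegularEpi.getStruct p).epi
    exact surjective_of_epi p
  intro T b h
  by_contra! hb
  have hP := IsPullback.of_hasPullback p (specializeHom h)
  have : IsRegularEpi (pullback.snd p (specializeHom h)) := hp _ _ _ hP.flip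
  exact notMem_closedSets_specialize (notMem_of_surjective hsurj hb)
    (mem_closedSets_of_isRegularEpi _ (preimage_mem_closedSets h hP hb))

end FCLS

/-! ### Isomorphisms of descent data -/

namespace Descent

section

variable {𝒞 : Type u} [Category.{v} 𝒞] [HasPullbacks 𝒞] {E B : 𝒞} {p : E ⟶ B}

/-- A morphism of descent data whose underlying morphism is invertible is invertible. -/
theorem DescentData.isIso_of_isIso_hom {D D' : DescentData p} (f : D ⟶ D')
    [IsIso (DescentData.Hom.hom f)] : IsIso f := by
  have w : inv (DescentData.Hom.hom f) ≫ D.γ = D'.γ := by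
    rw [IsIso.inv_comp_eq]
    exact f.w.symm
  have comm : D'.ξ ≫ inv (DescentData.Hom.hom f) =
      baseMap p (inv (DescentData.Hom.hom f)) (by rw [← Category.assoc, w]) ≫ D.ξ := by
    rw [IsIso.comp_inv_eq, Category.assoc, f.comm, ← Category.assoc]
    conv_lhs => rw [← Category.id_comp D'.ξ]
    congr 1
    apply pullback.hom_ext <;> simp
  exact ⟨⟨inv (DescentData.Hom.hom f), w, comm⟩,
    DescentData.Hom.ext (IsIso.hom_inv_id _), DescentData.Hom.ext (IsIso.inv_hom_id _)⟩

end

end Descent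

/-! ### Full faithfulness of the comparison functor -/

namespace FCLS

open Descent

variable {E B : FCLS.{u}} {p : E ⟶ B}

/-- Over a point outside the image the pullback is empty, so `K^p` cannot separate two maps between
spaces lying over it. -/
theorem surjective_of_faithful_comparison [(comparison p).Faithful] :
    Function.Surjective p.hom.toFun := by
  intro b
  by_contra! hb
  let α : discrete PUnit.{u + 1} ⟶ B := discreteHom fun _ => b
  let β : discrete (ULift.{u} Bool) ⟶ B := discreteHom fun _ => b
  let f (i : Bool) : Over.mk α ⟶ Over.mk β := Over.homMk (discreteHom fun _ => ⟨i⟩)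
  have h : f true = f false := by
    apply (comparison p).map_injective
    refine DescentData.Hom.ext (hom_ext fun z =>
      (hb ((pullback.fst p α).hom.toFun z) ?_).elim)
    exact toFun_congr pullback.condition z
  have := toFun_congr (congrArg (fun k => CommaMorphism.left k) h) PUnit.unit
  cases this

theorem liftsClosure_of_isDescentMorphism (hp : IsDescentMorphism p) : LiftsClosure p := by
  obtain ⟨_, _⟩ := hp
  have hsurj := surjective_of_faithful_comparison (p := p)
  intro T b h
  by_contra! hb
  have hbT := notMem_of_surjective hsurj hb
  let α := specializeHom h
  let u := specializeOffHom B T b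
  let v : Over.mk (u ≫ α) ⟶ Over.mk α := Over.homMk u
  have hP := IsPullback.of_hasPullback p α
  have hP' := IsPullback.of_hasPullback p (u ≫ α)
  have fst_eq (z) : (pullback.fst p α).hom.toFun ((baseMap p u rfl).hom.toFun z) =
      (pullback.fst p (u ≫ α)).hom.toFun z := toFun_congr (baseMap_fst p u rfl) z
  have snd_eq (z) : (pullback.snd p α).hom.toFun ((baseMap p u rfl).hom.toFun z) =
      (pullback.snd p (u ≫ α)).hom.toFun z := toFun_congr (baseMap_snd p u rfl) z
  have hiso : IsIso (baseMap p (x := u ≫ α) (y := α) u rfl) := by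
    refine isIso_of_bijective _ ⟨fun z z' hz => ?_, fun z => ?_⟩ fun Z hZ => ?_
    · refine ext_of_isPullback hP' ?_ ?_
      · rw [← fst_eq, hz, fst_eq]
      · rw [← snd_eq, hz, snd_eq]
    · obtain ⟨z', h₁, h₂⟩ := exists_of_isPullback hP'
        (e := (pullback.fst p α).hom.toFun z) (a := (pullback.snd p α).hom.toFun z)
        (toFun_congr hP.w z)
      exact ⟨z', ext_of_isPullback hP ((fst_eq z').trans h₁) ((snd_eq z').trans h₂)⟩
    · obtain ⟨E', hE, A', hA, rfl⟩ := (mem_closedSets_iff_of_isPullback hP').1 hZ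
      -- The two refinements differ only in that `T` is closed in the finer one, and the inverse
      -- image of `T` is closed anyway.
      have hA' : (pullback.snd p α).hom.toFun ⁻¹' A' ∈ (pullback p α).obj.closedSets := by
        by_cases hT : A' = T
        · have hA'T : (pullback.snd p α).hom.toFun ⁻¹' A' = (pullback.snd p α).hom.toFun ⁻¹' T :=
            congrArg (fun U : Set B.obj.carrier => (pullback.snd p α).hom.toFun ⁻¹' U) hT
          rw [hA'T]
          exact preimage_mem_closedSets h hP hb
        · exact (pullback.snd p α).hom.preimage_mem A' fun hTA => (hA hTA).resolve_right hT
      refine ⟨_, inter_mem _ ((pullback.fst p α).hom.preimage_mem _ hE) hA', ?_⟩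
      ext z
      change _ ∧ _ ↔ _ ∈ E' ∧ _ ∈ A'
      rw [fst_eq, snd_eq]
  have : IsIso (DescentData.Hom.hom ((comparison p).map v)) := hiso
  have := DescentData.isIso_of_isIso_hom ((comparison p).map v)
  have : IsIso v := isIso_of_reflects_iso v (comparison p)
  have hs : (inv v).left ≫ u = 𝟙 _ := congrArg (fun k => CommaMorphism.left k) (IsIso.inv_hom_id v)
  have hs' : (inv v).left.hom.toFun = id := funext fun x => toFun_congr hs x
  refine notMem_closedSets_specialize hbT ?_
  have := (inv v).left.hom.preimage_mem T fun _ => .inr rfl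
  rwa [hs'] at this

theorem faithful_comparison (hp : Function.Surjective p.hom.toFun) :
    (comparison p).Faithful where
  map_injective {A A'} f g hfg := by
    ext : 1
    refine hom_ext fun a => ?_
    obtain ⟨e, he⟩ := hp (A.hom.hom.toFun a)
    obtain ⟨z, -, rfl⟩ := exists_of_isPullback (IsPullback.of_hasPullback p A.hom) he
    have h : baseMap p f.left (Over.w f) = baseMap p g.left (Over.w g) :=
      congrArg DescentData.Hom.hom hfg
    have h' : pullback.snd p A.hom ≫ f.left = pullback.snd p A.hom ≫ g.left := by
      rw [← baseMap_snd p f.left (Over.w f), h, baseMap_snd]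
    exact toFun_congr h' z

/-- Compatibility with the actions makes the second component of `F` constant on the fibres of the
regular epimorphism `π`, so it descends to `A`. -/
theorem LiftsClosure.full_comparison (hp : LiftsClosure p) : (comparison p).Full where
  map_surjective {A A'} F := by
    have hP := IsPullback.of_hasPullback p A.hom
    let π := pullback.snd p A.hom
    let φ : pullback p A.hom ⟶ pullback p A'.hom := DescentData.Hom.hom F
    have hφ : φ ≫ pullback.fst p A'.hom = pullback.fst p A.hom := F.w
    have hq : IsRegularEpi π := hp.isPullbackStableRegularEpi _ _ _ hP.flip
    have : Epi π := (IsRegularEpi.getStruct π).epi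
    have comm : baseMap p π pullback.condition.symm ≫ φ ≫ pullback.snd p A'.hom =
        pullback.snd p (pullback.fst p A.hom ≫ p) ≫ φ ≫ pullback.snd p A'.hom := by
      have := F.comm =≫ pullback.snd p A'.hom
      refine (Category.assoc _ _ _).symm.trans (this.trans ((Category.assoc _ _ _).trans ?_))
      exact (congrArg (baseMap p φ _ ≫ ·) (baseMap_snd p _ pullback.condition.symm)).trans
        (baseMap_snd_assoc p φ _ _)
    have key : IsRegularEpi.left π ≫ φ ≫ pullback.snd p A'.hom =
        IsRegularEpi.right π ≫ φ ≫ pullback.snd p A'.hom := by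
      refine hom_ext fun x => ?_
      set y := (IsRegularEpi.left π).hom.toFun x
      set y' := (IsRegularEpi.right π).hom.toFun x
      have hy : π.hom.toFun y = π.hom.toFun y' := toFun_congr (IsRegularEpi.w π) x
      -- The point `z = (π₁ y, y')` is sent to `y` by `E ×_B π` and to `y'` by the projection.
      obtain ⟨z, h₁, h₂⟩ := exists_of_isPullback
        (IsPullback.of_hasPullback p (pullback.fst p A.hom ≫ p))
        (e := (pullback.fst p A.hom).hom.toFun y) (a := y') (by
          refine (toFun_congr hP.w y).trans (Eq.trans ?_ (toFun_congr hP.w y').symm)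
          exact congrArg A.hom.hom.toFun hy)
      have hz : (baseMap p π pullback.condition.symm).hom.toFun z = y := by
        refine ext_of_isPullback hP ?_ ?_
        · exact (toFun_congr (baseMap_fst p π pullback.condition.symm) z).trans h₁
        · refine (toFun_congr (baseMap_snd p π pullback.condition.symm) z).trans ?_
          exact (congrArg π.hom.toFun h₂).trans hy.symm
      have := toFun_congr comm z
      change (φ ≫ pullback.snd p A'.hom).hom.toFun _ =
        (φ ≫ pullback.snd p A'.hom).hom.toFun _ at this
      rw [hz, h₂] at this
      exact this
    let g := IsRegularEpi.desc π _ key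
    have hg : π ≫ g = φ ≫ pullback.snd p A'.hom := IsRegularEpi.fac π _ key
    have hw : g ≫ A'.hom = A.hom := by
      rw [← cancel_epi π, ← Category.assoc, hg, Category.assoc, ← pullback.condition,
        ← Category.assoc, hφ, pullback.condition]
    refine ⟨Over.homMk g hw, DescentData.Hom.ext (pullback.hom_ext ?_ ?_)⟩
    · exact (baseMap_fst p g hw).trans hφ.symm
    · exact (baseMap_snd p g hw).trans hg

/-! ### Essential surjectivity: the quotient by the action -/

section EssSurj

variable (D : DescentData p)

/-- The relation on the points of a descent datum `(C, γ, ξ)` that identifies `c` with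
`ξ (e, c)`. -/
def actRel (c c' : D.obj.obj.carrier) : Prop :=
  ∃ z, (pullback.snd p (D.γ ≫ p)).hom.toFun z = c ∧ D.ξ.hom.toFun z = c'

variable {D}

theorem actRel.base_eq {c c' : D.obj.obj.carrier} (h : actRel D c c') :
    p.hom.toFun (D.γ.hom.toFun c) = p.hom.toFun (D.γ.hom.toFun c') := by
  obtain ⟨z, rfl, rfl⟩ := h
  refine (toFun_congr pullback.condition z).symm.trans ?_
  exact congrArg p.hom.toFun (toFun_congr D.ξ_γ z).symm

theorem exists_actRel {e : E.obj.carrier} {c : D.obj.obj.carrier}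
    (h : p.hom.toFun e = p.hom.toFun (D.γ.hom.toFun c)) :
    ∃ c', D.γ.hom.toFun c' = e ∧ actRel D c c' := by
  obtain ⟨z, rfl, rfl⟩ := exists_of_isPullback (IsPullback.of_hasPullback p (D.γ ≫ p)) h
  exact ⟨_, toFun_congr D.ξ_γ z, z, rfl, rfl⟩

theorem actRel.refl (c : D.obj.obj.carrier) : actRel D c c :=
  ⟨_, toFun_congr (pullback.lift_snd D.γ (𝟙 D.obj) (by simp)) c, toFun_congr D.unit c⟩

theorem actRel.eq {c c' c'' : D.obj.obj.carrier} (h : actRel D c c') (h' : actRel D c c'')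
    (hγ : D.γ.hom.toFun c' = D.γ.hom.toFun c'') : c' = c'' := by
  obtain ⟨z, hz, rfl⟩ := h
  obtain ⟨z', hz', rfl⟩ := h'
  congr 1
  refine ext_of_isPullback (IsPullback.of_hasPullback p (D.γ ≫ p)) ?_ (hz.trans hz'.symm)
  exact ((toFun_congr D.ξ_γ z).symm.trans hγ).trans (toFun_congr D.ξ_γ z')

theorem actRel.trans {c c' c'' : D.obj.obj.carrier} (h : actRel D c c') (h' : actRel D c' c'') :
    actRel D c c'' := by
  have hP := IsPullback.of_hasPullback p (D.γ ≫ p)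
  obtain ⟨z, rfl, rfl⟩ := h
  obtain ⟨w, hw, rfl⟩ := h'
  -- With `z = (e, c)` and `w = (e', c')`, associativity is applied to `y = (e', z)`; the witness
  -- for the composite is `(e', c)`.
  obtain ⟨y, hy₁, hy₂⟩ := exists_of_isPullback
    (IsPullback.of_hasPullback p (pullback.fst p (D.γ ≫ p) ≫ p))
    (e := (pullback.fst p (D.γ ≫ p)).hom.toFun w) (a := z) (by
      refine (toFun_congr hP.w w).trans ?_
      change p.hom.toFun (D.γ.hom.toFun _) = _
      rw [hw]
      exact congrArg p.hom.toFun (toFun_congr D.ξ_γ z))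
  have h₁ : p.hom.toFun (D.γ.hom.toFun (D.ξ.hom.toFun z)) =
    p.hom.toFun ((pullback.fst p (D.γ ≫ p)).hom.toFun z) :=
      congrArg p.hom.toFun (toFun_congr D.ξ_γ z)
  have wξ : D.ξ ≫ D.γ ≫ p = pullback.fst p (D.γ ≫ p) ≫ p := by rw [← Category.assoc, D.ξ_γ]
  have hyw : (baseMap p D.ξ wξ).hom.toFun y = w := by
    refine ext_of_isPullback hP ?_ ?_
    · exact (toFun_congr (baseMap_fst p D.ξ wξ) y).trans hy₁
    · refine (toFun_congr (baseMap_snd p D.ξ wξ) y).trans ?_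
      exact (congrArg D.ξ.hom.toFun hy₂).trans hw.symm
  refine ⟨(baseMap p (pullback.snd p (D.γ ≫ p)) pullback.condition.symm).hom.toFun y, ?_, ?_⟩
  · refine (toFun_congr (baseMap_snd p _ pullback.condition.symm) y).trans ?_
    exact congrArg (pullback.snd p (D.γ ≫ p)).hom.toFun hy₂
  · refine (toFun_congr D.assoc y).symm.trans ?_
    exact congrArg D.ξ.hom.toFun hyw

/-- Acting on `c'` by `γ c` gives a point related to `c` and over the same point of `E` as `c`,
hence `c` itself. -/
theorem actRel.symm {c c' : D.obj.obj.carrier} (h : actRel D c c') : actRel D c' c := by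
  obtain ⟨c'', hγ, h'⟩ := exists_actRel h.base_eq
  rwa [(h.trans h').eq (actRel.refl c) hγ] at h'

variable (D) in
/-- The equivalence relation `actRel`. -/
def actSetoid : Setoid D.obj.obj.carrier where
  r := actRel D
  iseqv := ⟨actRel.refl, actRel.symm, actRel.trans⟩

variable (D) in
/-- The saturation of a set of points of a descent datum. -/
def saturation (S : Set D.obj.obj.carrier) : Set D.obj.obj.carrier :=
  {c | ∃ c' ∈ S, actRel D c c'}

theorem subset_saturation (S : Set D.obj.obj.carrier) : S ⊆ saturation D S :=
  fun c hc => ⟨c, hc, actRel.refl c⟩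

/-- Continuity of the action: `ξ⁻¹ S` is a closed box with projections `γ S` and the
saturation of `S`. -/
theorem mem_of_mem_cl_saturation {S : Set D.obj.obj.carrier} (hS : S ∈ D.obj.obj.closedSets)
    {c c' : D.obj.obj.carrier} (hc : c ∈ D.obj.cl (saturation D S))
    (hc' : D.γ.hom.toFun c' ∈ E.cl (D.γ.hom.toFun '' S)) (h : actRel D c c') : c' ∈ S := by
  obtain ⟨E', hE, C', hC, hZ⟩ := (mem_closedSets_iff_of_isPullback
    (IsPullback.of_hasPullback p (D.γ ≫ p))).1 (D.ξ.hom.preimage_mem S hS)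
  have hmem (z) : D.ξ.hom.toFun z ∈ S ↔ (pullback.fst p (D.γ ≫ p)).hom.toFun z ∈ E' ∧
      (pullback.snd p (D.γ ≫ p)).hom.toFun z ∈ C' := Set.ext_iff.1 hZ z
  have hγ (z) : D.γ.hom.toFun (D.ξ.hom.toFun z) = (pullback.fst p (D.γ ≫ p)).hom.toFun z :=
    toFun_congr D.ξ_γ z
  obtain ⟨z, rfl, rfl⟩ := h
  refine (hmem z).2 ⟨?_, cl_subset hC ?_ hc⟩
  · rw [← hγ]
    refine cl_subset hE ?_ hc'
    rintro _ ⟨s, hs, rfl⟩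
    obtain ⟨y, -, rfl⟩ := actRel.refl s
    rw [hγ]
    exact ((hmem y).1 hs).1
  · rintro _ ⟨s, hs, y, rfl, rfl⟩
    exact ((hmem y).1 hs).2

/-- Each closed set `S` is cut out, among the points over the closure of `γ S`, by a closed
saturated set. -/
theorem exists_saturated_closed {S : Set D.obj.obj.carrier} (hS : S ∈ D.obj.obj.closedSets) :
    ∃ T ∈ D.obj.obj.closedSets, S ⊆ T ∧ saturation D T ⊆ T ∧
      ∀ c ∈ T, D.γ.hom.toFun c ∈ E.cl (D.γ.hom.toFun '' S) → c ∈ S := by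
  have := D.obj.property
  -- A maximal `T` exists by finiteness. The closure of its saturation meets the same condition, so
  -- it is contained in `T`.
  obtain ⟨T, hST, ⟨⟨hT, hTS⟩, hmax⟩⟩ := (Set.toFinite {T | T ∈ D.obj.obj.closedSets ∧
    ∀ c ∈ T, D.γ.hom.toFun c ∈ E.cl (D.γ.hom.toFun '' S) → c ∈ S}).exists_le_maximal
      (a := S) ⟨hS, fun _ h _ => h⟩
  have hsub : saturation D T ⊆ D.obj.cl (saturation D T) := subset_cl _
  refine ⟨T, hT, hST, hsub.trans (hmax ⟨cl_mem _, fun c hc hγ => ?_⟩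
    ((subset_saturation T).trans hsub)), hTS⟩
  exact hTS c (mem_of_mem_cl_saturation hT hc (cl_mono (Set.image_mono hST) hγ) (actRel.refl c)) hγ

variable (D)

/-- The quotient of a descent datum by the action. -/
def actQuotient : FCLS.{u} :=
  have := D.obj.property
  of (Quotient (actSetoid D)) {T | Quotient.mk (actSetoid D) ⁻¹' T ∈ D.obj.obj.closedSets} (by
    intro S hS
    change Quotient.mk (actSetoid D) ⁻¹' ⋂₀ S ∈ D.obj.obj.closedSets
    rw [Set.preimage_sInter, ← Set.sInter_image]
    refine ClosureSpace.sInter_mem _ ?_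
    rintro _ ⟨U, hU, rfl⟩
    exact hS hU)

/-- The quotient map. -/
def actQuotientMk : D.obj ⟶ actQuotient D :=
  ObjectProperty.homMk { toFun := Quotient.mk (actSetoid D), preimage_mem := fun _ h => h }

/-- The structure morphism of the quotient. -/
def actQuotientHom : actQuotient D ⟶ B :=
  ObjectProperty.homMk
    { toFun := Quotient.lift (fun c => p.hom.toFun (D.γ.hom.toFun c)) fun _ _ h =>
        actRel.base_eq h
      preimage_mem := fun T hT => (D.γ ≫ p).hom.preimage_mem T hT }

theorem γ_comp_eq : D.γ ≫ p = actQuotientMk D ≫ actQuotientHom D := rfl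

theorem isIso_lift_actQuotientMk :
    IsIso (pullback.lift D.γ (actQuotientMk D) (γ_comp_eq D)) := by
  have hP := IsPullback.of_hasPullback p (actQuotientHom D)
  set f := pullback.lift D.γ (actQuotientMk D) (γ_comp_eq D)
  have fst_eq (c) : (pullback.fst p (actQuotientHom D)).hom.toFun (f.hom.toFun c) =
      D.γ.hom.toFun c := toFun_congr (pullback.lift_fst _ _ (γ_comp_eq D)) c
  have snd_eq (c) : (pullback.snd p (actQuotientHom D)).hom.toFun (f.hom.toFun c) =
      Quotient.mk (actSetoid D) c := toFun_congr (pullback.lift_snd _ _ (γ_comp_eq D)) c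
  refine isIso_of_bijective _ ⟨fun c c' h => ?_, fun z => ?_⟩ fun S hS => ?_
  · have hr : actRel D c c' := Quotient.exact (s := actSetoid D) (by rw [← snd_eq, h, snd_eq])
    exact (actRel.refl c).eq hr (by rw [← fst_eq, h, fst_eq])
  · obtain ⟨c, hc⟩ := Quotient.exists_rep (s := actSetoid D)
      ((pullback.snd p (actQuotientHom D)).hom.toFun z)
    obtain ⟨c', hγ, h⟩ := exists_actRel (D := D) (c := c)
      (e := (pullback.fst p (actQuotientHom D)).hom.toFun z)
      ((toFun_congr hP.w z).trans (congrArg (actQuotientHom D).hom.toFun hc.symm))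
    refine ⟨c', ext_of_isPullback hP ((fst_eq c').trans hγ) ((snd_eq c').trans ?_)⟩
    exact (Quotient.sound (s := actSetoid D) h).symm.trans hc
  · obtain ⟨T, hT, hST, hsat, hTS⟩ := exists_saturated_closed hS
    have hpre : Quotient.mk (actSetoid D) ⁻¹' (Quotient.mk (actSetoid D) '' T) = T := by
      refine Set.Subset.antisymm ?_ (Set.subset_preimage_image _ _)
      rintro c ⟨c', hc', h⟩
      exact hsat ⟨c', hc', actRel.symm (Quotient.exact (s := actSetoid D) h)⟩
    have hT' : (Quotient.mk (actSetoid D) '' T : Set (actQuotient D).obj.carrier) ∈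
        (actQuotient D).obj.closedSets := by
      change Quotient.mk (actSetoid D) ⁻¹' (Quotient.mk (actSetoid D) '' T) ∈ D.obj.obj.closedSets
      rwa [hpre]
    -- The box has sides `cl (γ S)` and the image of `T`, which is closed because `T` is saturated.
    refine ⟨_, (mem_closedSets_iff_of_isPullback hP).2
      ⟨_, cl_mem (D.γ.hom.toFun '' S), _, hT', rfl⟩, ?_⟩
    ext c
    have hcT : Quotient.mk (actSetoid D) c ∈ Quotient.mk (actSetoid D) '' T ↔ c ∈ T :=
      Set.ext_iff.1 hpre c
    change c ∈ S ↔ (pullback.fst p (actQuotientHom D)).hom.toFun (f.hom.toFun c) ∈ _ ∧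
      (pullback.snd p (actQuotientHom D)).hom.toFun (f.hom.toFun c) ∈ _
    rw [fst_eq, snd_eq]
    exact ⟨fun h => ⟨subset_cl _ ⟨c, h, rfl⟩, hcT.2 (hST h)⟩, fun h => hTS c (hcT.1 h.2) h.1⟩

/-- The comparison morphism from a descent datum to the one induced by its quotient. -/
noncomputable def toComparison : D ⟶ (comparison p).obj (Over.mk (actQuotientHom D)) where
  hom := pullback.lift D.γ (actQuotientMk D) (γ_comp_eq D)
  w := pullback.lift_fst _ _ _
  comm := by
    apply pullback.hom_ext
    · simp only [comparison, Category.assoc, baseMap_fst, Over.mk_hom, pullback.lift_fst, D.ξ_γ]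
    · simp only [comparison, Category.assoc, baseMap_snd, baseMap_snd_assoc, Over.mk_hom,
        pullback.lift_snd]
      exact hom_ext fun z => (Quotient.sound (s := actSetoid D) ⟨z, rfl, rfl⟩).symm

theorem essSurj_comparison (p : E ⟶ B) : (comparison p).EssSurj where
  mem_essImage D := by
    have : IsIso (DescentData.Hom.hom (toComparison D)) := isIso_lift_actQuotientMk D
    have := DescentData.isIso_of_isIso_hom (toComparison D)
    exact ⟨_, ⟨(asIso (toComparison D)).symm⟩⟩

end EssSurj

theorem LiftsClosure.isEffectiveDescentMorphism (hp : LiftsClosure p) :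
    IsEffectiveDescentMorphism p where
  faithful := faithful_comparison hp.surjective
  full := hp.full_comparison
  essSurj := essSurj_comparison p

end FCLS

theorem theorem4p3 {E B : FCLS.{u}} (p : E ⟶ B) :
    (Descent.IsDescentMorphism p ↔ Descent.IsPullbackStableRegularEpi p) ∧
      (Descent.IsDescentMorphism p → Descent.IsEffectiveDescentMorphism p) := by
  refine ⟨⟨fun h => (FCLS.liftsClosure_of_isDescentMorphism h).isPullbackStableRegularEpi,
    fun h => ?_⟩, fun h => (FCLS.liftsClosure_of_isDescentMorphism h).isEffectiveDescentMorphism⟩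
  have := (FCLS.liftsClosure_of_isPullbackStableRegularEpi h).isEffectiveDescentMorphism
  exact ⟨this.full, this.faithful⟩
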